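/- Let $\mathfrak g$ be a finite-dimensional simple Lie algebra over $\mathbb C$, let $\mathfrak h$ be a Cartan subalgebra of $\mathfrak g$, and let $(\cdot,\cdot)$ be a nondegenerate symmetric invariant bilinear form on $\mathfrak g$. Let $n\ge 2$ and $A=\mathbb C[t_1^{\pm1},\dots,t_n^{\pm1}]$, and write $X(m)=X\otimes t^m\in\mathfrak g\otimes A$ for $X\in\mathfrak g$, $m\in\mathbb Z^n$. Let $\mathcal Z=\Omega_A/dA$ be the complex vector space spanned by symbols $t^mK_i$ ($m\in\mathbb Z^n$, $1\le i\le n$) subject to the relations $\sum_i m_i\,t^mK_i=0$ for all $m \in \mathbb Z^n$, and write $K_i=t^0K_i$. The toroidal Lie algebra is $\tau=(\mathfrak g\otimes A)\oplus\mathcal Z\oplus D$, where $D$ has basis $d_1,\dots,d_n$, with the bracket $$[X(r),Y(s)]=[X,Y](r+s)+(X,Y)\sum_i r_i\,t^{r+s}K_i,\qquad [\mathcal Z,(\mathfrak g\otimes A)\oplus\mathcal Z]=0,$$ $$[d_i,X(r)]=r_iX(r),\qquad [d_i,t^mK_j]=m_i\,t^mK_j,\qquad [d_i,d_j]=0.$$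 Put $\underline{\mathfrak h}=\mathfrak h\oplus\bigoplus_i\mathbb CK_i\oplus\bigoplus_i\mathbb Cd_i$. A $\tau$-module $V$ is called integrable if it is the direct sum of its weight spaces $V_\lambda=\{v\in V: hv=\lambda(h)v\ \text{for all } h\in\underline{\mathfrak h}\}$, $\lambda\in\underline{\mathfrak h}^*$, and if for every root $\alpha$ of $(\mathfrak g,\mathfrak h)$, every root vector $X_\alpha\in\mathfrak g_\alpha$, every $m\in\mathbb Z^n$ and every $v\in V$ there is an integer $p\ge 0$ with $(X_\alpha(m))^pv=0$. For a $\tau$-module $V$ let $k=k(V)$ be the dimension of the $\mathbb C$-linear span in $\mathbb C^n$ of the set $$L=\{r,-r : r\in\mathbb Z^n,\ t^rK_i\ne 0 \text{ on } V \text{ for some } i\}.$$ Proposition. There is no irreducible integrable $\tau$-module $V$ with finite-dimensional weight spaces such that $k(V)\ge 1$ and all of $K_1,\dots,K_n$ act on $V$ by $0$. In other words, if $V$ is an irreducible integrable $\tau$-module with finite-dimensional weight spaces on which $K_1,\dots,K_n$ act by $0$, then all of $\mathcal Z$ acts on $V$ by $0$. -/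

import Mathlib

noncomputable section

namespace ToroidalLie

/-- A nondegenerate symmetric invariant bilinear form `(·,·)` on a complex Lie algebra `𝔤`.
On a finite-dimensional simple `𝔤` these are exactly the nonzero multiples of the Killing form;
the form normalised by `(β, β) = 2` for the highest root `β` is one of them. -/
structure InvariantForm (𝔤 : Type*) [LieRing 𝔤] [LieAlgebra ℂ 𝔤] where
  /-- the bilinear form -/
  form : LinearMap.BilinForm ℂ 𝔤
  symm : form.IsSymm
  invariant : form.lieInvariant 𝔤
  nondegenerate : form.Nondegenerate

/-- The vector of `ℂⁿ` with the integer coordinates `m`. -/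
def toC {n : ℕ} (m : Fin n → ℤ) : Fin n → ℂ := fun i => (m i : ℂ)

theorem toC_add {n : ℕ} (r s : Fin n → ℤ) : toC (r + s) = toC r + toC s := by
  ext i; simp [toC]

/-- The span of the elements `∑ i, m i • t^m K_i`, `m ∈ ℤⁿ`, in the vector space with basis the
symbols `t^m K_i`. In `(Fin n → ℤ) →₀ (Fin n → ℂ)` the symbol `t^m K_i` is the function that is
the `i`-th unit vector at `m` and `0` elsewhere. -/
def centreRel (n : ℕ) : Submodule ℂ ((Fin n → ℤ) →₀ (Fin n → ℂ)) :=
  Submodule.span ℂ (Set.range fun m : Fin n → ℤ => Finsupp.single m (toC m))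

/-- `𝒵 = Ω_A / dA`, spanned by the `t^m K_i` with the relations `∑ i, m i • t^m K_i = 0`
(`t^m K_i` is the class of the differential `t^m t_i⁻¹ dt_i`). -/
abbrev Centre (n : ℕ) : Type := ((Fin n → ℤ) →₀ (Fin n → ℂ)) ⧸ centreRel n

/-- `tK m u = ∑ i, u i • t^m K_i`. -/
def tK {n : ℕ} (m : Fin n → ℤ) : (Fin n → ℂ) →ₗ[ℂ] Centre n :=
  (centreRel n).mkQ ∘ₗ Finsupp.lsingle m

theorem tK_self {n : ℕ} (m : Fin n → ℤ) : tK m (toC m) = 0 :=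
  (Submodule.Quotient.mk_eq_zero _).2 (Submodule.subset_span ⟨m, rfl⟩)

theorem centre_induction {n : ℕ} {p : Centre n → Prop} (z : Centre n) (h0 : p 0)
    (ha : ∀ x y, p x → p y → p (x + y)) (hm : ∀ (m : Fin n → ℤ) (u : Fin n → ℂ), p (tK m u)) :
    p z := by
  induction z using Submodule.Quotient.induction_on with
  | H f =>
    induction f using Finsupp.induction_linear with
    | zero => exact h0
    | add f g hf hg => exact ha _ _ hf hg
    | single m u => exact hm m u

/-- The action of `∑ i, a i • d_i` on `𝒵`: `t^m K_j ↦ (∑ i, a i * m i) • t^m K_j`. -/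
def degZ {n : ℕ} (a : Fin n → ℂ) : Centre n →ₗ[ℂ] Centre n :=
  (centreRel n).liftQ (Finsupp.lsum ℂ fun m => (a ⬝ᵥ toC m) • tK m) (by
    refine Submodule.span_le.2 ?_
    rintro _ ⟨m, rfl⟩
    simp [tK_self])

theorem degZ_tK {n : ℕ} (a : Fin n → ℂ) (m : Fin n → ℤ) (u : Fin n → ℂ) :
    degZ a (tK m u) = (a ⬝ᵥ toC m) • tK m u := by
  simp [degZ, tK]

theorem degZ_add {n : ℕ} (a b : Fin n → ℂ) (z : Centre n) :
    degZ (a + b) z = degZ a z + degZ b z := by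
  induction z using centre_induction with
  | h0 => simp
  | ha x y hx hy => simp only [map_add, hx, hy]; abel
  | hm m X => simp [degZ_tK, add_dotProduct, add_smul]

theorem degZ_smul {n : ℕ} (c : ℂ) (a : Fin n → ℂ) (z : Centre n) :
    degZ (c • a) z = c • degZ a z := by
  induction z using centre_induction with
  | h0 => simp
  | ha x y hx hy => simp only [map_add, hx, hy, smul_add]
  | hm m X => simp [degZ_tK, mul_smul]

theorem degZ_comm {n : ℕ} (a b : Fin n → ℂ) (z : Centre n) :
    degZ a (degZ b z) = degZ b (degZ a z) := by
  induction z using centre_induction with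
  | h0 => simp
  | ha x y hx hy => simp only [map_add, hx, hy]
  | hm m X => simp only [degZ_tK, map_smul]; rw [smul_comm]

section Algebra

variable {𝔤 : Type*} [LieRing 𝔤] [LieAlgebra ℂ 𝔤]

/-- `𝔤_A = 𝔤 ⊗ A = ⨁ m, 𝔤 ⊗ t^m`, where `A = ℂ[t₁^±, …, tₙ^±]`, as the space of finitely
supported functions `ℤⁿ → 𝔤`: the element `X(m) = X ⊗ t^m` is `Finsupp.single m X`. -/
abbrev Loop (𝔤 : Type*) [LieRing 𝔤] (n : ℕ) := (Fin n → ℤ) →₀ 𝔤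

/-- The bilinear map on `𝔤_A` with `(X(r), Y(s)) ↦ φ r s X Y`. -/
def bisum {n : ℕ} {N : Type*} [AddCommGroup N] [Module ℂ N]
    (φ : (Fin n → ℤ) → (Fin n → ℤ) → 𝔤 →ₗ[ℂ] 𝔤 →ₗ[ℂ] N) :
    Loop 𝔤 n →ₗ[ℂ] Loop 𝔤 n →ₗ[ℂ] N :=
  Finsupp.lsum ℂ fun r => (Finsupp.lsum ℂ fun s => (φ r s).flip).flip

theorem bisum_single {n : ℕ} {N : Type*} [AddCommGroup N] [Module ℂ N]
    (φ : (Fin n → ℤ) → (Fin n → ℤ) → 𝔤 →ₗ[ℂ] 𝔤 →ₗ[ℂ] N) (r s : Fin n → ℤ) (X Y : 𝔤) :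
    bisum φ (Finsupp.single r X) (Finsupp.single s Y) = φ r s X Y := by
  simp [bisum]

/-- The bracket of `𝔤_A`: `(X(r), Y(s)) ↦ [X, Y](r + s)`. -/
def loopBracket (𝔤 : Type*) [LieRing 𝔤] [LieAlgebra ℂ 𝔤] (n : ℕ) :
    Loop 𝔤 n →ₗ[ℂ] Loop 𝔤 n →ₗ[ℂ] Loop 𝔤 n :=
  bisum fun r s =>
    (LinearMap.mk₂ ℂ (fun X Y : 𝔤 => ⁅X, Y⁆) add_lie smul_lie lie_add lie_smul).compr₂
      (Finsupp.lsingle (r + s))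

/-- The bilinear map `(X(r), Y(s)) ↦ (X, Y) d(t^r) t^s = (X, Y) ∑ i, r i • t^(r+s) K_i`. -/
def cocycle (B : InvariantForm 𝔤) (n : ℕ) : Loop 𝔤 n →ₗ[ℂ] Loop 𝔤 n →ₗ[ℂ] Centre n :=
  bisum fun r s => B.form.compr₂ (LinearMap.toSpanSingleton ℂ _ (tK (r + s) (toC r)))

/-- The action of `∑ i, a i • d_i` on `𝔤_A`: `X(m) ↦ (∑ i, a i * m i) • X(m)`. -/
def degL {n : ℕ} (a : Fin n → ℂ) : Loop 𝔤 n →ₗ[ℂ] Loop 𝔤 n :=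
  Finsupp.lsum ℂ fun m => (a ⬝ᵥ toC m) • Finsupp.lsingle m

theorem loopBracket_single {n : ℕ} (r s : Fin n → ℤ) (X Y : 𝔤) :
    loopBracket 𝔤 n (Finsupp.single r X) (Finsupp.single s Y)
      = Finsupp.single (r + s) ⁅X, Y⁆ := by
  simp [loopBracket, bisum_single]

theorem cocycle_single (B : InvariantForm 𝔤) {n : ℕ} (r s : Fin n → ℤ) (X Y : 𝔤) :
    cocycle B n (Finsupp.single r X) (Finsupp.single s Y)
      = B.form X Y • tK (r + s) (toC r) := by
  simp [cocycle, bisum_single]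

theorem degL_single {n : ℕ} (a : Fin n → ℂ) (m : Fin n → ℤ) (X : 𝔤) :
    degL a (Finsupp.single m X) = (a ⬝ᵥ toC m) • Finsupp.single m X := by
  simp [degL]

theorem degL_add {n : ℕ} (a b : Fin n → ℂ) (x : Loop 𝔤 n) :
    degL (a + b) x = degL a x + degL b x := by
  induction x using Finsupp.induction_linear with
  | zero => simp
  | add x y hx hy => simp only [map_add, hx, hy]; abel
  | single m X => rw [degL_single, degL_single, degL_single, add_dotProduct, add_smul]

theorem degL_smul {n : ℕ} (c : ℂ) (a : Fin n → ℂ) (x : Loop 𝔤 n) :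
    degL (c • a) x = c • degL a x := by
  induction x using Finsupp.induction_linear with
  | zero => simp
  | add x y hx hy => simp only [map_add, hx, hy, smul_add]
  | single m X => rw [degL_single, degL_single, smul_dotProduct, smul_assoc]

theorem degL_comm {n : ℕ} (a b : Fin n → ℂ) (x : Loop 𝔤 n) :
    degL a (degL b x) = degL b (degL a x) := by
  induction x using Finsupp.induction_linear with
  | zero => simp
  | add x y hx hy => simp only [map_add, hx, hy]
  | single m X => rw [degL_single, degL_single, map_smul, map_smul, degL_single, degL_single,
      smul_comm]

theorem degL_loopBracket {n : ℕ} (a : Fin n → ℂ) (x y : Loop 𝔤 n) :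
    degL a (loopBracket 𝔤 n x y)
      = loopBracket 𝔤 n (degL a x) y + loopBracket 𝔤 n x (degL a y) := by
  induction x using Finsupp.induction_linear with
  | zero => simp
  | add x x' hx hy => simp only [map_add, LinearMap.add_apply, hx, hy]; abel
  | single r X =>
    induction y using Finsupp.induction_linear with
    | zero => simp
    | add x y hx hy => simp only [map_add, hx, hy]; abel
    | single s Y =>
      rw [degL_single, degL_single, map_smul, map_smul, LinearMap.smul_apply,
        loopBracket_single, degL_single, toC_add, dotProduct_add, add_smul]

theorem degZ_cocycle (B : InvariantForm 𝔤) {n : ℕ} (a : Fin n → ℂ) (x y : Loop 𝔤 n) :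
    degZ a (cocycle B n x y) = cocycle B n (degL a x) y + cocycle B n x (degL a y) := by
  induction x using Finsupp.induction_linear with
  | zero => simp
  | add x x' hx hy => simp only [map_add, LinearMap.add_apply, hx, hy]; abel
  | single r X =>
    induction y using Finsupp.induction_linear with
    | zero => simp
    | add x y hx hy => simp only [map_add, hx, hy]; abel
    | single s Y =>
      rw [degL_single, degL_single, map_smul, map_smul, LinearMap.smul_apply, cocycle_single,
        map_smul, degZ_tK, toC_add, dotProduct_add, ← add_smul, smul_comm]

theorem loopBracket_swap {n : ℕ} (x y : Loop 𝔤 n) :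
    loopBracket 𝔤 n x y = - loopBracket 𝔤 n y x := by
  induction x using Finsupp.induction_linear with
  | zero => simp
  | add x x' hx hy => simp only [map_add, LinearMap.add_apply, hx, hy]; abel
  | single r X =>
    induction y using Finsupp.induction_linear with
    | zero => simp
    | add x y hx hy => simp only [map_add, LinearMap.add_apply, hx, hy]; abel
    | single s Y =>
      rw [loopBracket_single, loopBracket_single, ← Finsupp.single_neg, lie_skew, add_comm]

theorem cocycle_swap (B : InvariantForm 𝔤) {n : ℕ} (x y : Loop 𝔤 n) :
    cocycle B n x y = - cocycle B n y x := by
  induction x using Finsupp.induction_linear with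
  | zero => simp
  | add x x' hx hy => simp only [map_add, LinearMap.add_apply, hx, hy]; abel
  | single r X =>
    induction y using Finsupp.induction_linear with
    | zero => simp
    | add x y hx hy => simp only [map_add, LinearMap.add_apply, hx, hy]; abel
    | single s Y =>
      rw [cocycle_single, cocycle_single, eq_neg_iff_add_eq_zero, add_comm s r, B.symm.eq Y X,
        ← smul_add, ← map_add, ← toC_add, tK_self, smul_zero]

theorem loopBracket_self {n : ℕ} (x : Loop 𝔤 n) : loopBracket 𝔤 n x x = 0 := by
  have h : (2 : ℂ) • loopBracket 𝔤 n x x = 0 := by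
    rw [two_smul]; exact eq_neg_iff_add_eq_zero.1 (loopBracket_swap x x)
  exact (smul_eq_zero.1 h).resolve_left two_ne_zero

theorem cocycle_self (B : InvariantForm 𝔤) {n : ℕ} (x : Loop 𝔤 n) : cocycle B n x x = 0 := by
  have h : (2 : ℂ) • cocycle B n x x = 0 := by
    rw [two_smul]; exact eq_neg_iff_add_eq_zero.1 (cocycle_swap B x x)
  exact (smul_eq_zero.1 h).resolve_left two_ne_zero

theorem loopBracket_jacobi {n : ℕ} (x y z : Loop 𝔤 n) :
    loopBracket 𝔤 n x (loopBracket 𝔤 n y z)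
      = loopBracket 𝔤 n (loopBracket 𝔤 n x y) z + loopBracket 𝔤 n y (loopBracket 𝔤 n x z) := by
  induction x using Finsupp.induction_linear with
  | zero => simp
  | add x x' hx hy => simp only [map_add, LinearMap.add_apply, hx, hy]; abel
  | single r X =>
    induction y using Finsupp.induction_linear with
    | zero => simp
    | add x y hx hy => simp only [map_add, LinearMap.add_apply, hx, hy]; abel
    | single s Y =>
      induction z using Finsupp.induction_linear with
      | zero => simp
      | add x y hx hy => simp only [map_add, hx, hy]; abel
      | single t Z =>
        simp only [loopBracket_single]
        have e1 : r + (s + t) = r + s + t := by abel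
        have e2 : s + (r + t) = r + s + t := by abel
        rw [e1, e2, ← Finsupp.single_add, leibniz_lie]

theorem cocycle_jacobi (B : InvariantForm 𝔤) {n : ℕ} (x y z : Loop 𝔤 n) :
    cocycle B n x (loopBracket 𝔤 n y z)
      = cocycle B n (loopBracket 𝔤 n x y) z + cocycle B n y (loopBracket 𝔤 n x z) := by
  induction x using Finsupp.induction_linear with
  | zero => simp
  | add x x' hx hy => simp only [map_add, LinearMap.add_apply, hx, hy]; abel
  | single r X =>
    induction y using Finsupp.induction_linear with
    | zero => simp
    | add x y hx hy => simp only [map_add, LinearMap.add_apply, hx, hy]; abel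
    | single s Y =>
      induction z using Finsupp.induction_linear with
      | zero => simp
      | add x y hx hy => simp only [map_add, hx, hy]; abel
      | single t Z =>
        have h1 : B.form X ⁅Y, Z⁆ = B.form ⁅X, Y⁆ Z := by
          rw [← lie_skew X Y, map_neg, LinearMap.neg_apply, B.invariant, neg_neg]
        have h2 : B.form Y ⁅X, Z⁆ = - B.form ⁅X, Y⁆ Z := by
          rw [B.invariant, neg_neg]
        simp only [loopBracket_single, cocycle_single, h1, h2]
        have e1 : r + (s + t) = r + s + t := by abel
        have e2 : s + (r + t) = r + s + t := by abel
        rw [e1, e2, toC_add, map_add, smul_add, neg_smul]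
        abel

/-- The toroidal Lie algebra `τ = 𝔤_A ⊕ 𝒵 ⊕ D`. The triple `(x, z, a)` stands for
`x + z + ∑ i, a i • d_i`. The vector space does not depend on `B`, but the bracket does. -/
def Toroidal (_B : InvariantForm 𝔤) (n : ℕ) : Type _ :=
  Loop 𝔤 n × Centre n × (Fin n → ℂ)

namespace Toroidal

variable {B : InvariantForm 𝔤} {n : ℕ}

instance : AddCommGroup (Toroidal B n) :=
  inferInstanceAs (AddCommGroup (Loop 𝔤 n × Centre n × (Fin n → ℂ)))

instance : Module ℂ (Toroidal B n) :=
  inferInstanceAs (Module ℂ (Loop 𝔤 n × Centre n × (Fin n → ℂ)))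

/-- The bracket of `τ`:
`[X(r), Y(s)] = [X, Y](r + s) + (X, Y) ∑ i, r i • t^(r+s) K_i`, `[𝒵, 𝔤_A + 𝒵] = 0`,
`[d_i, X(r)] = r i • X(r)`, `[d_i, t^m K_j] = m i • t^m K_j`, `[d_i, d_j] = 0`. -/
instance : Bracket (Toroidal B n) (Toroidal B n) where
  bracket x y :=
    (loopBracket 𝔤 n x.1 y.1 + degL x.2.2 y.1 - degL y.2.2 x.1,
      cocycle B n x.1 y.1 + degZ x.2.2 y.2.1 - degZ y.2.2 x.2.1, 0)

theorem lie_def (x y : Toroidal B n) :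
    ⁅x, y⁆ = (loopBracket 𝔤 n x.1 y.1 + degL x.2.2 y.1 - degL y.2.2 x.1,
      cocycle B n x.1 y.1 + degZ x.2.2 y.2.1 - degZ y.2.2 x.2.1, 0) := rfl

theorem degL_zero (x : Loop 𝔤 n) : degL 0 x = 0 := by
  have h := degL_smul 0 0 x
  rwa [zero_smul, zero_smul] at h

theorem degZ_zero (z : Centre n) : degZ 0 z = 0 := by
  have h := degZ_smul 0 0 z
  rwa [zero_smul, zero_smul] at h

instance : LieRing (Toroidal B n) where
  add_lie := by
    rintro ⟨x, z, a⟩ ⟨x', z', a'⟩ ⟨y, w, b⟩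
    refine Prod.ext ?_ (Prod.ext ?_ (add_zero _).symm)
    · change loopBracket 𝔤 n (x + x') y + degL (a + a') y - degL b (x + x')
        = (loopBracket 𝔤 n x y + degL a y - degL b x)
          + (loopBracket 𝔤 n x' y + degL a' y - degL b x')
      rw [map_add, LinearMap.add_apply, degL_add, map_add]; abel
    · change cocycle B n (x + x') y + degZ (a + a') w - degZ b (z + z')
        = (cocycle B n x y + degZ a w - degZ b z) + (cocycle B n x' y + degZ a' w - degZ b z')
      rw [map_add, LinearMap.add_apply, degZ_add, map_add]; abel
  lie_add := by
    rintro ⟨y, w, b⟩ ⟨x, z, a⟩ ⟨x', z', a'⟩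
    refine Prod.ext ?_ (Prod.ext ?_ (add_zero _).symm)
    · change loopBracket 𝔤 n y (x + x') + degL b (x + x') - degL (a + a') y
        = (loopBracket 𝔤 n y x + degL b x - degL a y)
          + (loopBracket 𝔤 n y x' + degL b x' - degL a' y)
      rw [map_add, degL_add, map_add]; abel
    · change cocycle B n y (x + x') + degZ b (z + z') - degZ (a + a') w
        = (cocycle B n y x + degZ b z - degZ a w) + (cocycle B n y x' + degZ b z' - degZ a' w)
      rw [map_add, degZ_add, map_add]; abel
  lie_self := by
    rintro ⟨x, z, a⟩
    refine Prod.ext ?_ (Prod.ext ?_ rfl)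
    · change loopBracket 𝔤 n x x + degL a x - degL a x = 0
      rw [loopBracket_self]; abel
    · change cocycle B n x x + degZ a z - degZ a z = 0
      rw [cocycle_self]; abel
  leibniz_lie := by
    rintro ⟨x, z, a⟩ ⟨y, w, b⟩ ⟨u, v, c⟩
    refine Prod.ext ?_ (Prod.ext ?_ (add_zero _).symm)
    · change loopBracket 𝔤 n x (loopBracket 𝔤 n y u + degL b u - degL c y)
          + degL a (loopBracket 𝔤 n y u + degL b u - degL c y) - degL 0 x
        = (loopBracket 𝔤 n (loopBracket 𝔤 n x y + degL a y - degL b x) u + degL 0 u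
            - degL c (loopBracket 𝔤 n x y + degL a y - degL b x))
          + (loopBracket 𝔤 n y (loopBracket 𝔤 n x u + degL a u - degL c x)
            + degL b (loopBracket 𝔤 n x u + degL a u - degL c x) - degL 0 y)
      simp only [degL_zero, map_add, map_sub, LinearMap.add_apply, LinearMap.sub_apply,
        degL_loopBracket]
      rw [loopBracket_jacobi, degL_comm b a u, degL_comm c a y, degL_comm c b x,
        loopBracket_swap y (degL c x)]
      abel
    · change cocycle B n x (loopBracket 𝔤 n y u + degL b u - degL c y)
          + degZ a (cocycle B n y u + degZ b v - degZ c w) - degZ 0 z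
        = (cocycle B n (loopBracket 𝔤 n x y + degL a y - degL b x) u + degZ 0 v
            - degZ c (cocycle B n x y + degZ a w - degZ b z))
          + (cocycle B n y (loopBracket 𝔤 n x u + degL a u - degL c x)
            + degZ b (cocycle B n x u + degZ a v - degZ c z) - degZ 0 w)
      simp only [degZ_zero, map_add, map_sub, LinearMap.add_apply, LinearMap.sub_apply,
        degZ_cocycle]
      rw [cocycle_jacobi, degZ_comm b a v, degZ_comm c a w, degZ_comm c b z,
        cocycle_swap B y (degL c x)]
      abel

instance : LieAlgebra ℂ (Toroidal B n) where
  lie_smul := by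
    rintro t ⟨x, z, a⟩ ⟨y, w, b⟩
    refine Prod.ext ?_ (Prod.ext ?_ (smul_zero _).symm)
    · change loopBracket 𝔤 n x (t • y) + degL a (t • y) - degL (t • b) x
        = t • (loopBracket 𝔤 n x y + degL a y - degL b x)
      rw [map_smul, map_smul, degL_smul, smul_sub, smul_add]
    · change cocycle B n x (t • y) + degZ a (t • w) - degZ (t • b) z
        = t • (cocycle B n x y + degZ a w - degZ b z)
      rw [map_smul, map_smul, degZ_smul, smul_sub, smul_add]

/-- `X(m) = X ⊗ t^m` as an element of `τ`. -/
def ofLoop (B : InvariantForm 𝔤) (X : 𝔤) (m : Fin n → ℤ) : Toroidal B n :=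
  (Finsupp.single m X, 0, 0)

/-- The inclusion `𝒵 → τ`. -/
def ofCentre (B : InvariantForm 𝔤) (z : Centre n) : Toroidal B n := (0, z, 0)

/-- `t^m K_i` as an element of `τ`. -/
def tKi (B : InvariantForm 𝔤) (m : Fin n → ℤ) (i : Fin n) : Toroidal B n :=
  ofCentre B (tK m (Pi.single i 1))

/-- `K_i = t^0 K_i`, a zero-degree central element. -/
def K (B : InvariantForm 𝔤) (i : Fin n) : Toroidal B n := tKi B 0 i

/-- `d_i` as an element of `τ`. -/
def d (B : InvariantForm 𝔤) (i : Fin n) : Toroidal B n := (0, 0, Pi.single i 1)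

end Toroidal

section Modules

variable (H : LieSubalgebra ℂ 𝔤) (B : InvariantForm 𝔤) (n : ℕ)

/-- For a Cartan subalgebra `H` of `𝔤`, the abelian subalgebra
`h = H ⊕ ⨁ i, ℂ K_i ⊕ ⨁ i, ℂ d_i` of `τ`. -/
def torCartan : Submodule ℂ (Toroidal B n) :=
  Submodule.span ℂ ({x | ∃ X ∈ H, x = Toroidal.ofLoop B X 0} ∪
    Set.range (Toroidal.K B) ∪ Set.range (Toroidal.d B))

variable (V : Type*) [AddCommGroup V] [Module ℂ V] [LieRingModule (Toroidal B n) V]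
  [LieModule ℂ (Toroidal B n) V]

/-- The weight space `V_μ = {v | h v = μ(h) v for all h}` of a linear functional `μ` on the
subalgebra `torCartan H B n`. -/
def weightSpace (μ : Module.Dual ℂ (torCartan H B n)) : Submodule ℂ V where
  carrier := {v | ∀ h : torCartan H B n, ⁅(h : Toroidal B n), v⁆ = μ h • v}
  add_mem' := by
    intro v w hv hw h
    rw [lie_add, hv h, hw h, smul_add]
  zero_mem' := by
    intro h
    rw [lie_zero, smul_zero]
  smul_mem' := by
    intro c v hv h
    rw [lie_smul, hv h, smul_comm]

open scoped Classical in
/-- A `τ`-module is integrable if it is the direct sum of its weight spaces and for every root `α`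
of `(𝔤, H)`, every root vector `X` of root `α` and every `m ∈ ℤⁿ` the element `X(m)` acts locally
nilpotently. -/
structure IsIntegrable [LieRing.IsNilpotent H] : Prop where
  isInternal : DirectSum.IsInternal (weightSpace H B n V)
  locallyNilpotent : ∀ α : LieModule.Weight ℂ H 𝔤, α.IsNonZero →
    ∀ X ∈ LieAlgebra.rootSpace H α, ∀ (m : Fin n → ℤ) (v : V),
      ∃ k : ℕ, ((LieModule.toEnd ℂ (Toroidal B n) V (Toroidal.ofLoop B X m)) ^ k) v = 0

/-- The set `L = {r, -r | t^r K_i ≠ 0 on V for some i}`, as a subset of `ℂⁿ`. -/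
def centralDegrees : Set (Fin n → ℂ) :=
  {u | ∃ r : Fin n → ℤ, (∃ (i : Fin n) (v : V), ⁅Toroidal.tKi B r i, v⁆ ≠ 0) ∧
    (u = toC r ∨ u = toC (-r))}

/-- The dimension `k` of the `ℂ`-linear span of `L`. -/
def centralRank : ℕ := Module.finrank ℂ (Submodule.span ℂ (centralDegrees B n V))

end Modules

end Algebra

end ToroidalLie

end

/-!
Suppose that some `t^m K_i` acts on `V` by a nonzero operator `z`. The kernel of `z` is a submodule,
so `z` is injective (`centreOp_tK_injective`). Fix an `𝔰𝔩₂`-triple `(e, h, f)` of a root of `𝔤`; then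
`(e, f) ≠ 0` (`exists_rootTriple`). As the `K_i` act by zero, `e(r)`, `h(0)`, `f(-r)` satisfy the
relations of `𝔰𝔩₂` on `V` for every `r ∈ ℤⁿ`, with the same `h(0)` (`RootTriple.sl2Rel`).

There is a weight vector `w ≠ 0` with `e(r) w = 0` for all `r`
(`RootTriple.exists_forall_loopOp_e_eq_zero`). Otherwise one could raise a highest weight vector for
`e(0), h(0), f(0)`, of weight `μ` say, by elements `e(r)` indefinitely. An operator `f(-r)` is
injective on spaces of positive `h(0)`-weight, so all spaces of weights `μ + kα`, `k ∈ ℕ`, would be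
nonzero, which is impossible for a locally nilpotent action of `𝔰𝔩₂` with finite-dimensional weight
spaces (`Sl2Rel.exists_eq_bot`).

By the theory of `𝔰𝔩₂`, `h(0) w = N w` with `N ∈ ℕ` and `f(-r)^(N+1) w = 0` for all `r`. Let `y` be
the `i`-th unit vector of `ℤⁿ`. For every `x ∈ ℕ`,
`[e(xy + m), f(-xy)] = h(m) + (e, f) t^m (∑ m_j K_j) + x (e, f) z`,
so `e(xy + m)^(N+1) f(-xy)^(N+1) w` is a polynomial in `x` of degree at most `N + 1`, and its
coefficient in that degree is `(N+1)! (e, f)^(N+1) z^(N+1) w` (`LadderRel.hasLeading_pow`). The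
polynomial vanishes at all `x ∈ ℕ`, so `z^(N+1) w = 0`, against the injectivity of `z`.
-/

namespace ToroidalLie

/-! ### Operators satisfying the relations of `𝔰𝔩₂` -/

section Sl2

variable {V : Type*} [AddCommGroup V] [Module ℂ V]

theorem exists_pow_ne_zero {A : Module.End ℂ V} {u : V} (hu : u ≠ 0)
    (h : ∃ k : ℕ, (A ^ k) u = 0) : ∃ q : ℕ, (A ^ q) u ≠ 0 ∧ (A ^ (q + 1)) u = 0 := by
  classical
  obtain ⟨q, hq⟩ : ∃ q, Nat.find h = q + 1 :=
    Nat.exists_eq_succ_of_ne_zero fun h0 => hu (by simpa [h0] using Nat.find_spec h)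
  exact ⟨q, Nat.find_min h (by omega), hq ▸ Nat.find_spec h⟩

/-- The relations `[E, F] = H`, `[H, E] = 2E`, `[H, F] = -2F` between operators on `V`, evaluated
on vectors. Unlike for `IsSl2Triple`, the operator `H` may be zero. -/
structure Sl2Rel (E F H : Module.End ℂ V) : Prop where
  ef : ∀ v, E (F v) = F (E v) + H v
  he : ∀ v, H (E v) = E (H v) + (2 : ℂ) • E v
  hf : ∀ v, H (F v) = F (H v) - (2 : ℂ) • F v

namespace Sl2Rel

variable {E F H : Module.End ℂ V}

theorem symm (t : Sl2Rel E F H) : Sl2Rel F E (-H) where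
  ef v := by rw [t.ef]; simp
  he v := by
    rw [LinearMap.neg_apply, LinearMap.neg_apply, t.hf, map_neg]; abel
  hf v := by
    rw [LinearMap.neg_apply, LinearMap.neg_apply, t.he, map_neg]; abel

theorem apply_pow (t : Sl2Rel E F H) {u : V} {c : ℂ} (hu : H u = c • u) (k : ℕ) :
    H ((E ^ k) u) = (c + 2 * k) • (E ^ k) u := by
  induction k with
  | zero => simp [hu]
  | succ k ih =>
    rw [pow_succ', Module.End.mul_apply, t.he, ih, map_smul, ← add_smul]
    push_cast; ring_nf

theorem pow_succ_apply (t : Sl2Rel E F H) {u : V} {c : ℂ} (hu : H u = c • u) (k : ℕ) :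
    (E ^ (k + 1)) (F u) = F ((E ^ (k + 1)) u) + ((k + 1) * (c + k)) • (E ^ k) u := by
  induction k with
  | zero => simp [t.ef, hu]
  | succ k ih =>
    rw [pow_succ' E (k + 1), Module.End.mul_apply, ih, map_add, map_smul, t.ef, t.apply_pow hu,
      Module.End.mul_apply, ← Module.End.mul_apply E (E ^ k), ← pow_succ' E k, add_assoc,
      ← add_smul]
    push_cast; ring_nf

/-- If `E` is locally nilpotent, then `E F` is injective on the `c`-eigenspace of `H` unless `-c`
is a natural number. -/
theorem apply_apply_ne_zero (t : Sl2Rel E F H) (hE : ∀ v, ∃ k : ℕ, (E ^ k) v = 0) {u : V} {c : ℂ}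
    (hu : H u = c • u) (hc : ∀ k : ℕ, c + k ≠ 0) (hu0 : u ≠ 0) : E (F u) ≠ 0 := by
  obtain ⟨q, hq, hq'⟩ := exists_pow_ne_zero hu0 (hE u)
  intro h0
  have h := t.pow_succ_apply hu q
  rw [hq', map_zero, zero_add, pow_succ, Module.End.mul_apply, h0, map_zero] at h
  exact smul_ne_zero (mul_ne_zero (by exact_mod_cast q.succ_ne_zero) (hc q)) hq h.symm

/-- A highest weight vector on which `F` is nilpotent has a weight `N ∈ ℕ`. -/
theorem exists_nat_of_apply_eq_zero (t : Sl2Rel E F H) (hF : ∀ v, ∃ k : ℕ, (F ^ k) v = 0) {u : V}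
    {c : ℂ} (hu : H u = c • u) (hu0 : u ≠ 0) (hEu : E u = 0) :
    ∃ N : ℕ, c = N ∧ (F ^ (N + 1)) u = 0 := by
  obtain ⟨q, hq, hq'⟩ := exists_pow_ne_zero hu0 (hF u)
  refine ⟨q, ?_, hq'⟩
  have h := t.symm.pow_succ_apply (u := u) (c := -c) (by simp [hu]) q
  rw [hq', hEu, map_zero, map_zero, zero_add] at h
  have h1 := (smul_eq_zero.1 h.symm).resolve_right hq
  have h2 := (mul_eq_zero.1 h1).resolve_left (by exact_mod_cast q.succ_ne_zero)
  linear_combination -h2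

/-- A chain of finite-dimensional spaces of weights `N`, `N + 2`, … cannot go up forever: `E F` is
injective on each `W (j + 1)`, so `E` maps each `W j` onto `W (j + 1)`. Where the dimension is
minimal `E` is injective from there on, against local nilpotency. -/
theorem exists_eq_bot (t : Sl2Rel E F H) (hE : ∀ v, ∃ k : ℕ, (E ^ k) v = 0) (N : ℕ)
    (W : ℕ → Submodule ℂ V) [∀ j, FiniteDimensional ℂ (W j)]
    (hH : ∀ j, ∀ v ∈ W j, H v = ((N : ℂ) + 2 * j) • v)
    (hEW : ∀ j, ∀ v ∈ W j, E v ∈ W (j + 1)) (hFW : ∀ j, ∀ v ∈ W (j + 1), F v ∈ W j) :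
    ∃ j, W j = ⊥ := by
  have hsurj : ∀ j, Function.Surjective (E.restrict (hEW j)) := by
    intro j
    have hinj : Function.Injective ((E.restrict (hEW j)) ∘ₗ (F.restrict (hFW j))) := by
      refine (injective_iff_map_eq_zero _).2 fun v hv => ?_
      by_contra hv0
      refine t.apply_apply_ne_zero hE (hH _ v v.2) (fun k => ?_) (fun h => hv0 (Subtype.ext h))
        (congrArg Subtype.val hv)
      have : ((N + 2 * (j + 1) + k : ℕ) : ℂ) ≠ 0 := by
        rw [Nat.cast_ne_zero]; omega
      push_cast at this ⊢
      exact this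
    exact Function.Surjective.of_comp (LinearMap.surjective_of_injective hinj)
  have hanti : Antitone fun j => Module.finrank ℂ (W j) :=
    antitone_nat_of_succ_le fun j => LinearMap.finrank_le_finrank_of_surjective (hsurj j)
  obtain ⟨J, hJ⟩ : ∃ J, ∀ j, Module.finrank ℂ (W J) ≤ Module.finrank ℂ (W j) :=
    ⟨Function.argmin _, fun j => Function.argmin_le (fun j => Module.finrank ℂ (W j)) j⟩
  refine ⟨J, (Submodule.eq_bot_iff _).2 fun v hv => ?_⟩
  have hinj : ∀ j, J ≤ j → Function.Injective (E.restrict (hEW j)) := fun j hj =>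
    (LinearMap.injective_iff_surjective_of_finrank_eq_finrank
      (le_antisymm ((hanti hj).trans (hJ _)) (hanti j.le_succ))).2 (hsurj j)
  by_contra hv0
  have hpow : ∀ k, (E ^ k) v ∈ W (J + k) ∧ (E ^ k) v ≠ 0 := by
    intro k
    induction k with
    | zero => exact ⟨hv, hv0⟩
    | succ k ih =>
      rw [pow_succ', Module.End.mul_apply]
      refine ⟨hEW _ _ ih.1, fun h => ih.2 ?_⟩
      have := hinj (J + k) (Nat.le_add_right _ _) (a₁ := ⟨_, ih.1⟩) (a₂ := 0)
        (Subtype.ext (by simpa using! h))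
      exact congrArg Subtype.val this
  obtain ⟨k, hk⟩ := hE v
  exact (hpow k).2 hk

end Sl2Rel

end Sl2

/-! ### Vector-valued polynomial functions on `ℕ` -/

section Polynomial

variable {V : Type*} [AddCommGroup V] [Module ℂ V]

/-- `g : ℕ → V` is a polynomial function of degree at most `k` with coefficient `t` in
degree `k`. -/
def HasLeading (k : ℕ) (g : ℕ → V) (t : V) : Prop :=
  ∃ u : ℕ → V, ∀ x : ℕ, g x = ∑ i ∈ Finset.range k, (x : ℂ) ^ i • u i + (x : ℂ) ^ k • t

namespace HasLeading

variable {k : ℕ} {g g' : ℕ → V} {t t' : V}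

theorem const (w : V) : HasLeading 0 (fun _ => w) w := ⟨0, by simp⟩

theorem add (h : HasLeading k g t) (h' : HasLeading k g' t') :
    HasLeading k (fun x => g x + g' x) (t + t') := by
  obtain ⟨u, hu⟩ := h
  obtain ⟨u', hu'⟩ := h'
  refine ⟨u + u', fun x => ?_⟩
  simp only [hu, hu', Pi.add_apply, smul_add, Finset.sum_add_distrib]
  abel

theorem succ (h : HasLeading k g t) : HasLeading (k + 1) g 0 := by
  obtain ⟨u, hu⟩ := h
  refine ⟨Function.update u k t, fun x => ?_⟩
  rw [Finset.sum_range_succ, Function.update_self, smul_zero, add_zero, hu]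
  congr 1
  refine Finset.sum_congr rfl fun i hi => ?_
  rw [Function.update_of_ne (Finset.mem_range.1 hi).ne]

theorem mul_var (h : HasLeading k g t) : HasLeading (k + 1) (fun x => (x : ℂ) • g x) t := by
  obtain ⟨u, hu⟩ := h
  refine ⟨fun i => Nat.casesOn i 0 u, fun x => ?_⟩
  rw [Finset.sum_range_succ']
  simp [hu, smul_add, Finset.smul_sum, smul_smul, pow_succ']

theorem eq_zero (h : HasLeading k (fun _ => (0 : V)) t) : t = 0 := by
  obtain ⟨u, hu⟩ := h
  rw [← Module.forall_dual_apply_eq_zero_iff ℂ t]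
  intro φ
  -- The polynomial `∑ φ(u i) Xⁱ + φ(t) Xᵏ` vanishes on `ℕ`, so its coefficient in degree `k` is 0.
  let p : Polynomial ℂ := ∑ i ∈ Finset.range k, Polynomial.monomial i (φ (u i)) +
    Polynomial.monomial k (φ t)
  have hp : p = 0 := by
    refine Polynomial.eq_zero_of_infinite_isRoot p
      ((Set.infinite_range_of_injective (Nat.cast_injective (R := ℂ))).mono ?_)
    rintro _ ⟨x, rfl⟩
    have := congrArg φ (hu x)
    simp only [map_zero, map_add, map_sum, map_smul, smul_eq_mul] at this
    simp only [p, Set.mem_ofPred_eq, Polynomial.IsRoot, Polynomial.eval_add,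
      Polynomial.eval_finsetSum, Polynomial.eval_monomial]
    rw [this]
    simp only [mul_comm]
  have hc := congrArg (Polynomial.coeff · k) hp
  simpa [p, Polynomial.coeff_monomial, Finset.sum_ite_eq'] using hc

end HasLeading

end Polynomial

/-! ### Families of raising and lowering operators depending on a parameter -/

section Ladder

variable {V : Type*} [AddCommGroup V] [Module ℂ V]

/-- The commutation relations of operators `E x`, `F x j` depending linearly on a parameter
`x ∈ ℕ` through `[E x, F x j] = h j + x • z j`, together with a space `T` of vectors that are
killed by all `E x` and that is stable under all `h j` and `z j`. -/
structure LadderRel (E : ℕ → Module.End ℂ V) (F : ℕ → ℕ → Module.End ℂ V)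
    (h z : ℕ → Module.End ℂ V) (T : Submodule ℂ V) : Prop where
  ef : ∀ x j v, E x (F x j v) = F x j (E x v) + h j v + (x : ℂ) • z j v
  hf : ∀ x j l v, h j (F x l v) = F x l (h j v) - (2 : ℂ) • F x (j + l + 1) v
  zf : ∀ x j l v, z j (F x l v) = F x l (z j v)
  e_eq_zero : ∀ x, ∀ w ∈ T, E x w = 0
  h_mem : ∀ j, ∀ w ∈ T, h j w ∈ T
  z_mem : ∀ j, ∀ w ∈ T, z j w ∈ T

/-- The functions of `x ∈ ℕ` that are linear combinations of products of `k` lowering operators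
`F x j` applied to a fixed vector of `T`. -/
inductive Ladder (F : ℕ → ℕ → Module.End ℂ V) (T : Submodule ℂ V) : ℕ → (ℕ → V) → Prop
  | base {w : V} (hw : w ∈ T) : Ladder F T 0 fun _ => w
  | step {k : ℕ} {g : ℕ → V} (j : ℕ) (hg : Ladder F T k g) : Ladder F T (k + 1) fun x => F x j (g x)
  | add {k : ℕ} {g g' : ℕ → V} (hg : Ladder F T k g) (hg' : Ladder F T k g') :
    Ladder F T k fun x => g x + g' x
  | smul {k : ℕ} {g : ℕ → V} (c : ℂ) (hg : Ladder F T k g) : Ladder F T k fun x => c • g x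

variable {E : ℕ → Module.End ℂ V} {F : ℕ → ℕ → Module.End ℂ V} {h z : ℕ → Module.End ℂ V}
  {T : Submodule ℂ V}

namespace Ladder

theorem exists_eq_const {k : ℕ} {g : ℕ → V} (hg : Ladder F T k g) (hk : k = 0) :
    ∃ w ∈ T, g = fun _ => w := by
  induction hg with
  | base hw => exact ⟨_, hw, rfl⟩
  | step j _ _ => omega
  | add _ _ ih ih' =>
    obtain ⟨w, hw, rfl⟩ := ih hk
    obtain ⟨w', hw', rfl⟩ := ih' hk
    exact ⟨_, T.add_mem hw hw', rfl⟩
  | smul c _ ih =>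
    obtain ⟨w, hw, rfl⟩ := ih hk
    exact ⟨_, T.smul_mem c hw, rfl⟩

theorem h_apply (hr : LadderRel E F h z T) (j : ℕ) {k : ℕ} {g : ℕ → V} (hg : Ladder F T k g) :
    Ladder F T k fun x => h j (g x) := by
  induction hg with
  | base hw => exact .base (hr.h_mem j _ hw)
  | step l hg ih =>
    simp only [hr.hf, sub_eq_add_neg, ← neg_smul]
    exact (ih.step l).add ((hg.step _).smul _)
  | add _ _ ih ih' => simpa only [map_add] using ih.add ih'
  | smul c _ ih => simpa only [map_smul] using ih.smul c

theorem z_apply (hr : LadderRel E F h z T) (j : ℕ) {k : ℕ} {g : ℕ → V} (hg : Ladder F T k g) :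
    Ladder F T k fun x => z j (g x) := by
  induction hg with
  | base hw => exact .base (hr.z_mem j _ hw)
  | step l hg ih =>
    simp only [hr.zf]
    exact ih.step l
  | add _ _ ih ih' => simpa only [map_add] using ih.add ih'
  | smul c _ ih => simpa only [map_smul] using ih.smul c

/-- One raising operator removes one lowering operator, at the cost of at most one factor `x`. -/
theorem exists_e_apply_eq (hr : LadderRel E F h z T) {k : ℕ} {g : ℕ → V} (hg : Ladder F T k g) :
    (k = 0 ∧ ∀ x, E x (g x) = 0) ∨ ∃ k', k = k' + 1 ∧ ∃ g₁ g₂, Ladder F T k' g₁ ∧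
      Ladder F T k' g₂ ∧ ∀ x, E x (g x) = g₁ x + (x : ℂ) • g₂ x := by
  induction hg with
  | base hw => exact .inl ⟨rfl, fun x => hr.e_eq_zero x _ hw⟩
  | @step k g j hg ih =>
    refine .inr ⟨k, rfl, ?_⟩
    have hh := hg.h_apply hr j
    have hz := hg.z_apply hr j
    rcases ih with ⟨-, h0⟩ | ⟨k', rfl, g₁, g₂, h₁, h₂, he⟩
    · exact ⟨_, _, hh, hz, fun x => by rw [hr.ef, h0, map_zero, zero_add]⟩
    · refine ⟨_, _, (h₁.step j).add hh, (h₂.step j).add hz, fun x => ?_⟩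
      rw [hr.ef, he, map_add, map_smul, smul_add]
      abel
  | add _ _ ih ih' =>
    rcases ih with ⟨rfl, h0⟩ | ⟨k', rfl, g₁, g₂, h₁, h₂, he⟩
    · rcases ih' with ⟨-, h0'⟩ | ⟨k', hk, -⟩
      · exact .inl ⟨rfl, fun x => by rw [map_add, h0, h0', add_zero]⟩
      · omega
    · rcases ih' with ⟨hk, -⟩ | ⟨k'', hk, g₁', g₂', h₁', h₂', he'⟩
      · omega
      · obtain rfl : k' = k'' := by omega
        refine .inr ⟨k', rfl, _, _, h₁.add h₁', h₂.add h₂', fun x => ?_⟩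
        rw [map_add, he, he', smul_add]
        abel
  | smul c _ ih =>
    rcases ih with ⟨rfl, h0⟩ | ⟨k', rfl, g₁, g₂, h₁, h₂, he⟩
    · exact .inl ⟨rfl, fun x => by rw [map_smul, h0, smul_zero]⟩
    · refine .inr ⟨k', rfl, _, _, h₁.smul c, h₂.smul c, fun x => ?_⟩
      rw [map_smul, he, smul_add, smul_comm c]

theorem exists_hasLeading (hr : LadderRel E F h z T) {k : ℕ} {g : ℕ → V} (hg : Ladder F T k g) :
    ∃ t, HasLeading k (fun x => (E x ^ k) (g x)) t := by
  induction k generalizing g with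
  | zero =>
    obtain ⟨w, -, rfl⟩ := hg.exists_eq_const rfl
    exact ⟨w, .const w⟩
  | succ k ih =>
    rcases hg.exists_e_apply_eq hr with ⟨hk, -⟩ | ⟨k', hk, g₁, g₂, h₁, h₂, he⟩
    · omega
    · obtain rfl : k = k' := by omega
      obtain ⟨t₁, ht₁⟩ := ih h₁
      obtain ⟨t₂, ht₂⟩ := ih h₂
      refine ⟨0 + t₂, ?_⟩
      simp only [pow_succ, Module.End.mul_apply, he, map_add, map_smul]
      exact ht₁.succ.add ht₂.mul_var

end Ladder

namespace LadderRel

theorem ladder_pow (k : ℕ) {w : V} (hw : w ∈ T) : Ladder F T k fun x => (F x 0 ^ k) w := by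
  induction k with
  | zero => exact .base hw
  | succ k ih => simpa only [pow_succ', Module.End.mul_apply] using ih.step 0

theorem z_pow_apply (hr : LadderRel E F h z T) (x k : ℕ) (w : V) :
    z 0 ((F x 0 ^ k) w) = (F x 0 ^ k) (z 0 w) := by
  induction k with
  | zero => rfl
  | succ k ih => simp only [pow_succ', Module.End.mul_apply, hr.zf, ih]

theorem exists_e_pow_succ_eq (hr : LadderRel E F h z T) (k : ℕ) {w : V} (hw : w ∈ T) :
    ∃ g, Ladder F T k g ∧ ∀ x, E x ((F x 0 ^ (k + 1)) w)
      = g x + (x : ℂ) • ((k + 1 : ℂ) • (F x 0 ^ k) (z 0 w)) := by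
  induction k with
  | zero =>
    refine ⟨_, .base (hr.h_mem 0 w hw), fun x => ?_⟩
    simp [hr.ef, hr.e_eq_zero x w hw]
  | succ k ih =>
    obtain ⟨g, hg, he⟩ := ih
    refine ⟨_, (hg.step 0).add ((ladder_pow (k + 1) hw).h_apply hr 0), fun x => ?_⟩
    rw [pow_succ' (F x 0) (k + 1), Module.End.mul_apply, hr.ef, he, hr.z_pow_apply, map_add,
      map_smul, map_smul, ← Module.End.mul_apply (F x 0) (F x 0 ^ k), ← pow_succ']
    push_cast
    module

/-- The leading coefficient of `x ↦ (E x) ^ k (F x 0) ^ k w`: the top power `x ^ k` arises only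
by taking the central part `x • z 0` of each commutator. -/
theorem hasLeading_pow (hr : LadderRel E F h z T) (k : ℕ) {w : V} (hw : w ∈ T) :
    HasLeading k (fun x => (E x ^ k) ((F x 0 ^ k) w)) ((k.factorial : ℂ) • (z 0 ^ k) w) := by
  induction k generalizing w with
  | zero => simpa using HasLeading.const w
  | succ k ih =>
    obtain ⟨g, hg, he⟩ := hr.exists_e_pow_succ_eq k hw
    obtain ⟨t, ht⟩ := hg.exists_hasLeading hr
    have h1 := ih (T.smul_mem (k + 1 : ℂ) (hr.z_mem 0 w hw))
    have h2 := ht.succ.add h1.mul_var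
    have e1 : (0 : V) + (k.factorial : ℂ) • (z 0 ^ k) ((k + 1 : ℂ) • z 0 w)
        = ((k + 1).factorial : ℂ) • (z 0 ^ (k + 1)) w := by
      rw [zero_add, map_smul, smul_smul, pow_succ, Module.End.mul_apply, Nat.factorial_succ]
      push_cast
      rw [mul_comm]
    rw [e1] at h2
    simpa only [pow_succ (E _) k, Module.End.mul_apply, he, map_add, map_smul] using h2

/-- If the lowering operators `F x 0` are nilpotent on `w` of an order not depending on `x`, then
`z 0` is nilpotent on `w`. -/
theorem z_pow_eq_zero (hr : LadderRel E F h z T) {k : ℕ} {w : V} (hw : w ∈ T)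
    (hF : ∀ x, (F x 0 ^ k) w = 0) : (z 0 ^ k) w = 0 := by
  have h1 := hr.hasLeading_pow k hw
  simp only [hF, map_zero] at h1
  exact (smul_eq_zero.1 h1.eq_zero).resolve_left (by exact_mod_cast k.factorial_ne_zero)

end LadderRel

end Ladder

/-! ### A root triple of the simple Lie algebra -/

section Roots

variable {𝔤 : Type*} [LieRing 𝔤] [LieAlgebra ℂ 𝔤]

theorem InvariantForm.eq_zero_of_lie_eq_smul (B : InvariantForm 𝔤) {h x : 𝔤} {c : ℂ} (hc : c ≠ 0)
    (hx : ⁅h, x⁆ = c • x) : B.form h x = 0 := by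
  have h1 := B.invariant h h x
  rw [lie_self, map_zero, LinearMap.zero_apply, hx, map_smul, smul_eq_mul, zero_eq_neg] at h1
  exact (mul_eq_zero.1 h1).resolve_left hc

theorem InvariantForm.eq_zero_of_weights (B : InvariantForm 𝔤) {h x y : 𝔤} {a b : ℂ}
    (hab : a + b ≠ 0) (hx : ⁅h, x⁆ = a • x) (hy : ⁅h, y⁆ = b • y) : B.form x y = 0 := by
  have h1 := B.invariant h x y
  rw [hx, hy, map_smul, LinearMap.smul_apply, map_smul, smul_eq_mul, smul_eq_mul] at h1
  exact (mul_eq_zero.1 (by linear_combination h1 : (a + b) * B.form x y = 0)).resolve_left hab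

/-- An `𝔰𝔩₂`-triple `(e, h, f)` of a root `α`, encoded through the action of `H`
on `e` and `f` and the conditions `α(h) = 2` and `(e, f) ≠ 0`. -/
structure RootTriple (H : LieSubalgebra ℂ 𝔤) [LieRing.IsNilpotent H] (B : InvariantForm 𝔤) where
  /-- the root -/
  α : LieModule.Weight ℂ H 𝔤
  /-- the root of `f`, which is opposite to `α` -/
  α' : LieModule.Weight ℂ H 𝔤
  /-- a linear functional on `𝔤` that extends the root -/
  a : Module.Dual ℂ 𝔤
  /-- the root vector of root `α` -/
  e : 𝔤
  /-- the root vector of root `-α` -/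
  f : 𝔤
  /-- the coroot -/
  h : 𝔤
  isNonZero : α.IsNonZero
  isNonZero' : α'.IsNonZero
  e_mem : e ∈ LieAlgebra.rootSpace H α
  f_mem : f ∈ LieAlgebra.rootSpace H α'
  h_mem : h ∈ H
  lie_e : ∀ x ∈ H, ⁅x, e⁆ = a x • e
  lie_f : ∀ x ∈ H, ⁅x, f⁆ = (-a) x • f
  lie_e_f : ⁅e, f⁆ = h
  a_h : a h = 2
  form_ne_zero : B.form e f ≠ 0

open LieAlgebra LieAlgebra.IsKilling LieModule in
theorem exists_rootTriple [FiniteDimensional ℂ 𝔤] [LieAlgebra.IsSimple ℂ 𝔤]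
    (H : LieSubalgebra ℂ 𝔤) [H.IsCartanSubalgebra] (B : InvariantForm 𝔤) :
    Nonempty (RootTriple H B) := by
  obtain ⟨α, hα⟩ : ∃ α : Weight ℂ H 𝔤, α.IsNonZero := by
    by_contra! hno
    have hempty : {α : Weight ℂ H 𝔤 | α.IsNonZero} = ∅ := by
      ext α; simpa using hno α
    have hspan := span_weight_isNonZero_eq_top ℂ 𝔤 H
    rw [hempty, Set.image_empty, Submodule.span_empty] at hspan
    -- Without roots the dual of `H` is zero, so `H` and its normalizer are too.
    have hH : ∀ x : H, x = 0 := fun x => by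
      rw [← Module.forall_dual_apply_eq_zero_iff ℂ x]
      intro φ
      have : φ ∈ (⊥ : Submodule ℂ (Module.Dual ℂ H)) := hspan ▸ Submodule.mem_top
      rw [(Submodule.mem_bot ℂ).1 this, LinearMap.zero_apply]
    refine LieAlgebra.IsSimple.non_abelian (R := ℂ) (L := 𝔤) ⟨fun x y => ?_⟩
    have hx : x ∈ H.normalizer := by
      rw [LieSubalgebra.mem_normalizer_iff]
      intro z hz
      rw [show z = 0 from congrArg Subtype.val (hH ⟨z, hz⟩), lie_zero]
      exact H.zero_mem
    rw [LieSubalgebra.IsCartanSubalgebra.self_normalizing] at hx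
    rw [show x = 0 from congrArg Subtype.val (hH ⟨x, hx⟩), zero_lie]
  obtain ⟨h, e, f, ht, he, hf⟩ := exists_isSl2Triple_of_weight_isNonZero hα
  obtain ⟨a, ha⟩ := LinearMap.exists_extend (p := H.toSubmodule) α.toLinear
  have ha' : ∀ x : H, a x = α x := fun x => LinearMap.congr_fun ha x
  have hh := ht.h_eq_coroot hα he hf
  have hlie_e : ∀ x : H, ⁅(x : 𝔤), e⁆ = α x • e := lie_eq_smul_of_mem_rootSpace he
  refine ⟨⟨α, -α, a, e, f, h, hα, hα.neg, he, hf, hh ▸ (coroot α).2, fun x hx => ?_,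
    fun x hx => ?_, ht.lie_e_f, ?_, fun hB => ht.e_ne_zero ?_⟩⟩
  · rw [ha' ⟨x, hx⟩]
    exact hlie_e ⟨x, hx⟩
  · rw [LinearMap.neg_apply, ha' ⟨x, hx⟩]
    exact lie_eq_smul_of_mem_rootSpace hf ⟨x, hx⟩
  · rw [hh, ha', root_apply_coroot hα]
  · -- `e` is orthogonal to every root space: to that of `-α` as it is spanned by `f`.
    refine B.nondegenerate.1 e fun y => ?_
    have hy : y ∈ ⨆ χ : Weight ℂ H 𝔤, rootSpace H χ := by
      rw [iSup_genWeightSpace_eq_top']; exact LieSubmodule.mem_top y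
    induction hy using LieSubmodule.iSup_induction' with
    | zero => exact map_zero _
    | add y y' _ _ h1 h2 => rw [map_add, h1, h2, add_zero]
    | mem χ y hy =>
      by_cases hχ : χ = -α
      · subst hχ
        obtain ⟨c, hc⟩ := (finrank_eq_one_iff_of_nonzero' ⟨f, hf⟩ (by simp [ht.f_ne_zero])).mp
          (finrank_rootSpace_eq_one (-α) (by simpa using hα)) ⟨y, hy⟩
        rw [show y = c • f from (congrArg Subtype.val hc).symm, map_smul, hB, smul_zero]
      · obtain ⟨x, hx⟩ : ∃ x : H, α x + χ x ≠ 0 := by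
          by_contra! h0
          refine hχ (Weight.ext fun x => ?_)
          rw [Weight.coe_neg, Pi.neg_apply, eq_neg_iff_add_eq_zero, add_comm]
          exact h0 x
        exact B.eq_zero_of_weights hx (hlie_e x) (lie_eq_smul_of_mem_rootSpace hy x)

end Roots

/-! ### Brackets and weights in the toroidal Lie algebra -/

section Toroidal

open Toroidal

variable {𝔤 : Type*} [LieRing 𝔤] [LieAlgebra ℂ 𝔤] {B : InvariantForm 𝔤} {n : ℕ}

theorem lie_ofLoop_ofLoop (X Y : 𝔤) (r s : Fin n → ℤ) :
    ⁅ofLoop B X r, ofLoop B Y s⁆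
      = ofLoop B ⁅X, Y⁆ (r + s) + ofCentre B (B.form X Y • tK (r + s) (toC r)) := by
  rw [lie_def]
  refine Prod.ext ?_ (Prod.ext ?_ (add_zero _).symm)
  · change loopBracket 𝔤 n (Finsupp.single r X) (Finsupp.single s Y) + degL 0 (Finsupp.single s Y)
      - degL 0 (Finsupp.single r X) = Finsupp.single (r + s) ⁅X, Y⁆ + 0
    rw [loopBracket_single, degL_zero, degL_zero, sub_zero]
  · change cocycle B n (Finsupp.single r X) (Finsupp.single s Y) + degZ 0 0 - degZ 0 0
      = 0 + B.form X Y • tK (r + s) (toC r)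
    rw [cocycle_single, map_zero, add_zero, sub_zero, zero_add]

theorem lie_ofCentre (x : Toroidal B n) (z : Centre n) :
    ⁅x, ofCentre B z⁆ = ofCentre B (degZ x.2.2 z) := by
  rw [lie_def]
  refine Prod.ext ?_ (Prod.ext ?_ rfl)
  · change loopBracket 𝔤 n x.1 0 + degL x.2.2 0 - degL 0 x.1 = 0
    rw [map_zero, map_zero, degL_zero, add_zero, sub_zero]
  · change cocycle B n x.1 0 + degZ x.2.2 z - degZ 0 x.2.1 = degZ x.2.2 z
    rw [map_zero, degZ_zero, zero_add, sub_zero]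

/-- The functional `x + z + ∑ i, a i • d_i ↦ b(x₀) + ∑ i, a i * r i` on `τ`, where `x₀` is the
coefficient of `t⁰` in `x`. On `torCartan` it is the weight of `X(r)` for `X` of weight `b`. -/
def rootFunctional (B : InvariantForm 𝔤) (b : Module.Dual ℂ 𝔤) (r : Fin n → ℤ) :
    Module.Dual ℂ (Toroidal B n) where
  toFun x := b (x.1 0) + x.2.2 ⬝ᵥ toC r
  map_add' x y := by
    change b ((x.1 + y.1) 0) + (x.2.2 + y.2.2) ⬝ᵥ toC r = _
    rw [Finsupp.add_apply, map_add, add_dotProduct]; ring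
  map_smul' c x := by
    change b ((c • x.1) 0) + (c • x.2.2) ⬝ᵥ toC r = c * _
    rw [Finsupp.smul_apply, map_smul, smul_dotProduct, smul_eq_mul, smul_eq_mul]; ring

theorem rootFunctional_apply (b : Module.Dual ℂ 𝔤) (r : Fin n → ℤ) (x : Toroidal B n) :
    rootFunctional B b r x = b (x.1 0) + x.2.2 ⬝ᵥ toC r := rfl

theorem rootFunctional_ofLoop (b : Module.Dual ℂ 𝔤) (r : Fin n → ℤ) (X : 𝔤) :
    rootFunctional B b r (ofLoop B X 0) = b X := by
  rw [rootFunctional_apply]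
  change b (Finsupp.single 0 X 0) + (0 : Fin n → ℂ) ⬝ᵥ toC r = b X
  rw [Finsupp.single_eq_same, zero_dotProduct, add_zero]

theorem rootFunctional_add (b b' : Module.Dual ℂ 𝔤) (r r' : Fin n → ℤ) :
    rootFunctional B b r + rootFunctional B b' r' = rootFunctional B (b + b') (r + r') := by
  ext x
  simp only [LinearMap.add_apply, rootFunctional_apply, toC_add, dotProduct_add]
  ring

theorem lie_torCartan_ofLoop {H : LieSubalgebra ℂ 𝔤} {X : 𝔤} {b : Module.Dual ℂ 𝔤}
    (hX : ∀ x ∈ H, ⁅x, X⁆ = b x • X) (r : Fin n → ℤ) {y : Toroidal B n}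
    (hy : y ∈ torCartan H B n) :
    ⁅y, ofLoop B X r⁆ = rootFunctional B b r y • ofLoop B X r := by
  induction hy using Submodule.span_induction with
  | zero => rw [zero_lie, map_zero, zero_smul]
  | add x y _ _ hx hy => rw [add_lie, map_add, add_smul, hx, hy]
  | smul c x _ hx => rw [smul_lie, map_smul, hx, smul_assoc]
  | mem y hy =>
    rcases hy with (⟨x, hx, rfl⟩ | ⟨i, rfl⟩) | ⟨i, rfl⟩
    · rw [rootFunctional_ofLoop, lie_ofLoop_ofLoop, hX x hx, show toC (0 : Fin n → ℤ) = 0 by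
        ext i; simp [toC], map_zero, smul_zero, zero_add]
      refine Prod.ext ?_ (Prod.ext ?_ ?_)
      · change Finsupp.single r (b x • X) + 0 = b x • Finsupp.single r X
        rw [add_zero, Finsupp.smul_single]
      · exact (add_zero _).trans (smul_zero _).symm
      · exact (add_zero _).trans (smul_zero _).symm
    · rw [← lie_skew, K, tKi, lie_ofCentre, rootFunctional_apply]
      change -ofCentre B (degZ 0 _) = (b 0 + (0 : Fin n → ℂ) ⬝ᵥ toC r) • _
      rw [degZ_zero, map_zero, zero_dotProduct, add_zero, zero_smul]
      exact neg_zero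
    · rw [lie_def, rootFunctional_apply]
      refine Prod.ext ?_ (Prod.ext ?_ (smul_zero _).symm)
      · change loopBracket 𝔤 n 0 (Finsupp.single r X) + degL (Pi.single i 1) (Finsupp.single r X)
          - degL 0 0 = (b 0 + Pi.single i 1 ⬝ᵥ toC r) • Finsupp.single r X
        rw [map_zero, map_zero, map_zero, LinearMap.zero_apply, degL_single, zero_add, sub_zero,
          zero_add]
      · change cocycle B n 0 (Finsupp.single r X) + degZ (Pi.single i 1) 0 - degZ 0 0
          = (b 0 + Pi.single i 1 ⬝ᵥ toC r) • (0 : Centre n)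
        simp

/-! ### The operators of a toroidal module -/

variable (V : Type*) [AddCommGroup V] [Module ℂ V] [LieRingModule (Toroidal B n) V]
  [LieModule ℂ (Toroidal B n) V]

/-- The operator `X(r)` on `V`. -/
noncomputable def loopOp (B : InvariantForm 𝔤) [LieRingModule (Toroidal B n) V]
    [LieModule ℂ (Toroidal B n) V] (X : 𝔤) (r : Fin n → ℤ) : Module.End ℂ V :=
  LieModule.toEnd ℂ (Toroidal B n) V (ofLoop B X r)

/-- The action of the centre `𝒵` on `V`, as a linear map. -/
noncomputable def centreOp (B : InvariantForm 𝔤) [LieRingModule (Toroidal B n) V]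
    [LieModule ℂ (Toroidal B n) V] : Centre n →ₗ[ℂ] Module.End ℂ V :=
  (LieModule.toEnd ℂ (Toroidal B n) V : Toroidal B n →ₗ[ℂ] Module.End ℂ V) ∘ₗ
    { toFun := ofCentre B
      map_add' := fun _ _ => Prod.ext (add_zero _).symm (Prod.ext rfl (add_zero _).symm)
      map_smul' := fun _ _ => Prod.ext (smul_zero _).symm (Prod.ext rfl (smul_zero _).symm) }

variable {V}

theorem centreOp_apply (z : Centre n) (v : V) : centreOp V B z v = ⁅ofCentre B z, v⁆ := rfl

theorem loopOp_apply (X : 𝔤) (r : Fin n → ℤ) (v : V) : loopOp V B X r v = ⁅ofLoop B X r, v⁆ := rfl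

theorem loopOp_smul (c : ℂ) (X : 𝔤) (r : Fin n → ℤ) :
    loopOp V B (c • X) r = c • loopOp V B X r := by
  rw [loopOp, loopOp, ← map_smul]
  congr 1
  refine Prod.ext (Finsupp.smul_single _ _ _).symm
    (Prod.ext (smul_zero _).symm (smul_zero _).symm)

theorem loopOp_comm (X Y : 𝔤) (r s : Fin n → ℤ) (v : V) :
    loopOp V B X r (loopOp V B Y s v) = loopOp V B Y s (loopOp V B X r v)
      + loopOp V B ⁅X, Y⁆ (r + s) v + B.form X Y • centreOp V B (tK (r + s) (toC r)) v := by
  rw [← LinearMap.smul_apply, ← map_smul, centreOp_apply]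
  simp only [loopOp_apply]
  rw [leibniz_lie, lie_ofLoop_ofLoop, add_lie]
  abel

theorem centreOp_comm (z : Centre n) (X : 𝔤) (r : Fin n → ℤ) (v : V) :
    centreOp V B z (loopOp V B X r v) = loopOp V B X r (centreOp V B z v) := by
  have h : ⁅ofLoop B X r, ofCentre B z⁆ = 0 := by
    rw [lie_ofCentre]
    change ofCentre B (degZ 0 z) = 0
    rw [degZ_zero]
    rfl
  rw [centreOp_apply, centreOp_apply, loopOp_apply, loopOp_apply, leibniz_lie (ofLoop B X r), h,
    zero_lie, zero_add]

theorem centreOp_tK_eq_zero {m : Fin n → ℤ} (h : ∀ (i : Fin n) (v : V), ⁅tKi B m i, v⁆ = 0)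
    (u : Fin n → ℂ) : centreOp V B (tK m u) = 0 := by
  have : centreOp V B ∘ₗ tK m = 0 := by
    refine LinearMap.pi_ext' fun i => LinearMap.ext_ring (LinearMap.ext fun v => ?_)
    exact h i v
  exact LinearMap.congr_fun this u

/-- The kernel of an element `t^m u` of `𝒵` is a submodule, so in an irreducible module that
element acts injectively unless it acts by zero. -/
theorem centreOp_tK_injective (hirr : LieModule.IsIrreducible ℂ (Toroidal B n) V)
    {m : Fin n → ℤ} {u : Fin n → ℂ} (hz : centreOp V B (tK m u) ≠ 0) :
    ∀ v, centreOp V B (tK m u) v = 0 → v = 0 := by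
  let W : LieSubmodule ℂ (Toroidal B n) V :=
    { LinearMap.ker (centreOp V B (tK m u)) with
      lie_mem := by
        intro x v hv
        change ⁅ofCentre B (tK m u), v⁆ = 0 at hv
        change ⁅ofCentre B (tK m u), ⁅x, v⁆⁆ = 0
        have h : centreOp V B ((x.2.2 ⬝ᵥ toC m) • tK m u) v = 0 := by
          rw [map_smul, LinearMap.smul_apply, centreOp_apply, hv, smul_zero]
        rw [leibniz_lie, hv, lie_zero, add_zero, ← lie_skew, lie_ofCentre, neg_lie, degZ_tK,
          ← centreOp_apply, h, neg_zero] }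
  rcases eq_bot_or_eq_top W with h | h
  · intro v hv
    have : v ∈ W := hv
    rwa [h, LieSubmodule.mem_bot] at this
  · refine absurd (LinearMap.ext fun v => ?_) hz
    have : v ∈ W := h ▸ LieSubmodule.mem_top v
    exact this

theorem loopOp_mem_weightSpace {H : LieSubalgebra ℂ 𝔤} {X : 𝔤} {b : Module.Dual ℂ 𝔤}
    (hX : ∀ x ∈ H, ⁅x, X⁆ = b x • X) {μ : Module.Dual ℂ (torCartan H B n)} {b' : Module.Dual ℂ 𝔤}
    {r r' : Fin n → ℤ} {v : V}
    (hv : v ∈ weightSpace H B n V (μ + (rootFunctional B b' r').domRestrict _)) :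
    loopOp V B X r v ∈
      weightSpace H B n V (μ + (rootFunctional B (b' + b) (r' + r)).domRestrict _) := by
  intro y
  have hy := hv y
  rw [loopOp_apply, leibniz_lie, hy, lie_torCartan_ofLoop hX r y.2, lie_smul, smul_lie, ← add_smul,
    ← rootFunctional_add]
  simp only [LinearMap.add_apply, LinearMap.domRestrict_apply]
  ring_nf

/-! ### A vector killed by all `e(r)` -/

section Highest

variable {H : LieSubalgebra ℂ 𝔤} [LieRing.IsNilpotent H] (t : RootTriple H B)

theorem RootTriple.lie_h_e : ⁅t.h, t.e⁆ = (2 : ℂ) • t.e := by rw [t.lie_e _ t.h_mem, t.a_h]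

theorem RootTriple.lie_h_f : ⁅t.h, t.f⁆ = (-2 : ℂ) • t.f := by
  rw [t.lie_f _ t.h_mem, LinearMap.neg_apply, t.a_h]

/-- As the `K_i` act by zero, the triple `e(r)`, `f(-r)` has the same `h` for all `r`. -/
theorem RootTriple.sl2Rel (hK : ∀ u, centreOp V B (tK (0 : Fin n → ℤ) u) = 0) (r : Fin n → ℤ) :
    Sl2Rel (loopOp V B t.e r) (loopOp V B t.f (-r)) (loopOp V B t.h (0 : Fin n → ℤ)) where
  ef v := by
    rw [loopOp_comm, t.lie_e_f, add_neg_cancel, hK, LinearMap.zero_apply, smul_zero, add_zero]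
  he v := by
    rw [loopOp_comm, t.lie_h_e, zero_add, loopOp_smul, B.eq_zero_of_lie_eq_smul two_ne_zero
      t.lie_h_e, zero_smul, add_zero, LinearMap.smul_apply]
  hf v := by
    rw [loopOp_comm, t.lie_h_f, zero_add, loopOp_smul, B.eq_zero_of_lie_eq_smul
      (neg_ne_zero.2 two_ne_zero) t.lie_h_f, zero_smul, add_zero, LinearMap.smul_apply, neg_smul,
      sub_eq_add_neg]

/-- The weight spaces of weights `μ + kα + r`, for `k` large and all `r ∈ ℤⁿ`, vanish: for `r = 0`
this is the theory of `𝔰𝔩₂`, and `f(-r)` embeds the space for `k + 1` and `r` into the one for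
`k` and `0`. So raising a weight vector by the `e(r)` must end. -/
theorem RootTriple.exists_forall_loopOp_e_eq_zero (hK : ∀ u, centreOp V B (tK (0 : Fin n → ℤ) u) = 0)
    (hint : IsIntegrable H B n V)
    (hfin : ∀ μ : Module.Dual ℂ (torCartan H B n), FiniteDimensional ℂ (weightSpace H B n V μ))
    [Nontrivial V] :
    ∃ w : V, w ≠ 0 ∧ (∃ c : ℂ, loopOp V B t.h (0 : Fin n → ℤ) w = c • w) ∧
      ∀ r : Fin n → ℤ, loopOp V B t.e r w = 0 := by
  classical
  have hE : ∀ (r : Fin n → ℤ) v, ∃ k : ℕ, (loopOp V B t.e r ^ k) v = 0 :=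
    fun r v => hint.locallyNilpotent t.α t.isNonZero t.e t.e_mem r v
  have hF : ∀ (r : Fin n → ℤ) v, ∃ k : ℕ, (loopOp V B t.f r ^ k) v = 0 :=
    fun r v => hint.locallyNilpotent t.α' t.isNonZero' t.f t.f_mem r v
  -- The weight space of weight `μ + kα + r`.
  let W (μ : Module.Dual ℂ (torCartan H B n)) (k : ℕ) (r : Fin n → ℤ) : Submodule ℂ V :=
    weightSpace H B n V (μ + (rootFunctional B (k • t.a) r).domRestrict _)
  have hWe : ∀ μ k r s v, v ∈ W μ k r → loopOp V B t.e s v ∈ W μ (k + 1) (r + s) := by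
    intro μ k r s v hv
    have := loopOp_mem_weightSpace t.lie_e (r := s) hv
    rwa [← succ_nsmul] at this
  have hWf : ∀ μ k r s v, v ∈ W μ (k + 1) r → loopOp V B t.f s v ∈ W μ k (r + s) := by
    intro μ k r s v hv
    have := loopOp_mem_weightSpace t.lie_f (r := s) hv
    rwa [succ_nsmul, add_neg_cancel_right] at this
  have hWh : ∀ μ k r v, v ∈ W μ k r → loopOp V B t.h (0 : Fin n → ℤ) v
      = (μ ⟨ofLoop B t.h 0, Submodule.subset_span (.inl (.inl ⟨t.h, t.h_mem, rfl⟩))⟩ + 2 * k) •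
        v := by
    intro μ k r v hv
    refine (hv ⟨ofLoop B t.h 0,
      Submodule.subset_span (.inl (.inl ⟨t.h, t.h_mem, rfl⟩))⟩).trans ?_
    rw [LinearMap.add_apply, LinearMap.domRestrict_apply, rootFunctional_ofLoop,
      LinearMap.smul_apply, t.a_h, nsmul_eq_mul, mul_comm]
  obtain ⟨μ, v, hv, hv0⟩ : ∃ μ, ∃ v ∈ weightSpace H B n V μ, v ≠ 0 := by
    by_contra! h0
    have htop := hint.isInternal.submodule_iSup_eq_top
    rw [iSup_eq_bot.2 fun μ => (Submodule.eq_bot_iff _).2 (h0 μ)] at htop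
    exact bot_ne_top htop
  have hv : v ∈ W μ 0 0 := by
    change v ∈ weightSpace H B n V _
    convert hv
    ext y
    simp [rootFunctional_apply, toC, dotProduct]
  obtain ⟨q, hq, hq'⟩ := exists_pow_ne_zero hv0 (hE 0 v)
  have hWq : ∀ q, (loopOp V B t.e (0 : Fin n → ℤ) ^ q) v ∈ W μ q 0 := by
    intro q
    induction q with
    | zero => exact hv
    | succ q ih =>
      rw [pow_succ', Module.End.mul_apply]
      simpa using hWe μ q 0 0 _ ih
  rw [pow_succ', Module.End.mul_apply] at hq'
  have rel0 := t.sl2Rel (V := V) hK 0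
  rw [neg_zero] at rel0
  obtain ⟨N, hN, -⟩ :=
    rel0.exists_nat_of_apply_eq_zero (hF 0) (hWh _ _ _ _ (hWq q)) hq hq'
  have hWhN : ∀ k r u, u ∈ W μ (q + k) r → loopOp V B t.h (0 : Fin n → ℤ) u = ((N : ℂ) + 2 * k) • u := by
    intro k r u hu
    rw [hWh _ _ _ _ hu, ← hN]
    push_cast; ring_nf
  have : ∀ k, FiniteDimensional ℂ (W μ (q + k) 0) := fun k => hfin _
  obtain ⟨j, hj⟩ := rel0.exists_eq_bot (hE 0) N (fun k => W μ (q + k) 0)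
    (fun k u hu => hWhN k 0 u hu)
    (fun k u hu => by simpa [add_assoc] using hWe μ _ 0 0 u hu)
    (fun k u hu => by simpa using hWf μ _ 0 0 u hu)
  by_contra! hno
  have hup : ∀ k, ∃ r, ∃ u ∈ W μ (q + k) r, u ≠ 0 := by
    intro k
    induction k with
    | zero => exact ⟨0, _, hWq q, hq⟩
    | succ k ih =>
      obtain ⟨r, u, hu, hu0⟩ := ih
      obtain ⟨s, hs⟩ := hno u hu0 ⟨_, hWh _ _ _ _ hu⟩
      exact ⟨r + s, _, hWe _ _ _ _ _ hu, hs⟩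
  obtain ⟨r, u, hu, hu0⟩ := hup (j + 1)
  have hfu : loopOp V B t.f (-r) u = 0 := by
    have := hWf μ (q + j) r (-r) u hu
    rw [add_neg_cancel, hj] at this
    exact this
  refine (t.sl2Rel (V := V) hK r).apply_apply_ne_zero (hE r) (hWhN _ _ _ hu) (fun k => ?_) hu0
    (by rw [hfu, map_zero])
  have : ((N + 2 * (j + 1) + k : ℕ) : ℂ) ≠ 0 := by
    rw [Nat.cast_ne_zero]; omega
  push_cast at this ⊢
  exact this

/-- The operators `e(xy + m)` and `f(-xy + jm)`: their brackets are `h((j+1)m)` up to central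
elements that depend on `x` through a multiple of `x • t^((j+1)m) y`. -/
theorem RootTriple.ladderRel (y m : Fin n → ℤ) :
    LadderRel (fun x => loopOp V B t.e (x • y + m))
      (fun x j => loopOp V B t.f (-(x • y) + j • m))
      (fun j => loopOp V B t.h ((j + 1) • m)
        + B.form t.e t.f • centreOp V B (tK ((j + 1) • m) (toC m)))
      (fun j => B.form t.e t.f • centreOp V B (tK ((j + 1) • m) (toC y)))
      (⨅ r : Fin n → ℤ, LinearMap.ker (loopOp V B t.e r)) where
  ef x j v := by
    have h1 : x • y + m + (-(x • y) + j • m) = (j + 1) • m := by rw [succ_nsmul]; abel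
    have h2 : toC (x • y + m) = (x : ℂ) • toC y + toC m := by ext i; simp [toC]
    rw [loopOp_comm, h1, h2, t.lie_e_f, map_add, map_smul, map_add, map_smul]
    simp only [LinearMap.add_apply, LinearMap.smul_apply]
    module
  hf x j l v := by
    have h1 : (j + 1) • m + (-(x • y) + l • m) = -(x • y) + (j + l + 1) • m := by
      simp only [add_nsmul]; abel
    rw [LinearMap.add_apply, LinearMap.add_apply, loopOp_comm, h1, t.lie_h_f, loopOp_smul,
      B.eq_zero_of_lie_eq_smul (neg_ne_zero.2 two_ne_zero) t.lie_h_f, map_add,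
      LinearMap.smul_apply, LinearMap.smul_apply, LinearMap.smul_apply, centreOp_comm, map_smul]
    module
  zf x j l v := by
    rw [LinearMap.smul_apply, LinearMap.smul_apply, centreOp_comm, map_smul]
  e_eq_zero x w hw := (Submodule.mem_iInf _).1 hw _
  h_mem j w hw := by
    have hw' : ∀ r : Fin n → ℤ, loopOp V B t.e r w = 0 := fun r => (Submodule.mem_iInf _).1 hw r
    refine (Submodule.mem_iInf _).2 fun r => ?_
    have h1 := loopOp_comm (B := B) (V := V) t.h t.e ((j + 1) • m) r w
    rw [t.lie_h_e, loopOp_smul, LinearMap.smul_apply, B.eq_zero_of_lie_eq_smul two_ne_zero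
      t.lie_h_e, hw', hw', map_zero, smul_zero, zero_smul, add_zero, add_zero] at h1
    rw [LinearMap.mem_ker, LinearMap.add_apply, LinearMap.smul_apply, map_add, map_smul,
      ← centreOp_comm, hw', map_zero, smul_zero, add_zero, ← h1]
  z_mem j w hw := by
    refine (Submodule.mem_iInf _).2 fun r => ?_
    rw [LinearMap.mem_ker, LinearMap.smul_apply, map_smul, ← centreOp_comm,
      show loopOp V B t.e r w = 0 from (Submodule.mem_iInf _).1 hw r, map_zero, smul_zero]

end Highest

theorem centreOp_tK_eq_zero_of_irreducible [FiniteDimensional ℂ 𝔤] [LieAlgebra.IsSimple ℂ 𝔤]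
    (H : LieSubalgebra ℂ 𝔤) [H.IsCartanSubalgebra]
    (hirr : LieModule.IsIrreducible ℂ (Toroidal B n) V) (hint : IsIntegrable H B n V)
    (hfin : ∀ μ : Module.Dual ℂ (torCartan H B n), FiniteDimensional ℂ (weightSpace H B n V μ))
    (hK : ∀ (i : Fin n) (v : V), ⁅K B i, v⁆ = 0) (m y : Fin n → ℤ) :
    centreOp V B (tK m (toC y)) = 0 := by
  by_contra hz
  obtain ⟨t⟩ := exists_rootTriple H B
  have hinj := centreOp_tK_injective hirr hz
  have : Nontrivial V := by
    by_contra hV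
    rw [not_nontrivial_iff_subsingleton] at hV
    exact hz (LinearMap.ext fun v => Subsingleton.elim _ _)
  have hK' : ∀ u, centreOp V B (tK (0 : Fin n → ℤ) u) = 0 := centreOp_tK_eq_zero hK
  obtain ⟨w, hw0, ⟨c, hc⟩, hw⟩ := t.exists_forall_loopOp_e_eq_zero (V := V) hK' hint hfin
  have hnil : ∀ r : Fin n → ℤ, ∃ N : ℕ, c = N ∧ (loopOp V B t.f (-r) ^ (N + 1)) w = 0 := fun r =>
    (t.sl2Rel hK' r).exists_nat_of_apply_eq_zero
      (fun v => hint.locallyNilpotent t.α' t.isNonZero' t.f t.f_mem (-r) v) hc hw0 (hw r)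
  obtain ⟨N, hN, -⟩ := hnil 0
  have hpow := (t.ladderRel (V := V) y m).z_pow_eq_zero (k := N + 1)
    ((Submodule.mem_iInf _).2 hw) fun x => by
      obtain ⟨N', hN', h⟩ := hnil (x • y)
      obtain rfl : N = N' := by exact_mod_cast hN.symm.trans hN'
      simpa using h
  rw [zero_add, one_nsmul, smul_pow, LinearMap.smul_apply] at hpow
  have hpow' := (smul_eq_zero.1 hpow).resolve_left (pow_ne_zero _ t.form_ne_zero)
  refine hw0 ?_
  clear hpow
  generalize N + 1 = k at hpow'
  induction k with
  | zero => exact hpow'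
  | succ k ih =>
    rw [pow_succ', Module.End.mul_apply] at hpow'
    exact ih (hinj _ hpow')

end Toroidal

end ToroidalLie

theorem mainTheorem3 {𝔤 : Type*} [LieRing 𝔤] [LieAlgebra ℂ 𝔤] [FiniteDimensional ℂ 𝔤]
    [LieAlgebra.IsSimple ℂ 𝔤] (H : LieSubalgebra ℂ 𝔤) [H.IsCartanSubalgebra]
    (B : ToroidalLie.InvariantForm 𝔤) (n : ℕ) (hn : 2 ≤ n)
    (V : Type*) [AddCommGroup V] [Module ℂ V] [LieRingModule (ToroidalLie.Toroidal B n) V]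
    [LieModule ℂ (ToroidalLie.Toroidal B n) V]
    (hirr : LieModule.IsIrreducible ℂ (ToroidalLie.Toroidal B n) V)
    (hint : ToroidalLie.IsIntegrable H B n V)
    (hfin : ∀ μ : Module.Dual ℂ (ToroidalLie.torCartan H B n),
      FiniteDimensional ℂ (ToroidalLie.weightSpace H B n V μ))
    (hK : ∀ (i : Fin n) (v : V), ⁅ToroidalLie.Toroidal.K B i, v⁆ = 0) :
    ¬ 1 ≤ ToroidalLie.centralRank B n V ∧
      ∀ (z : ToroidalLie.Centre n) (v : V), ⁅ToroidalLie.Toroidal.ofCentre B z, v⁆ = 0 := by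
  have hm : ∀ (m : Fin n → ℤ) (i : Fin n) (v : V), ⁅ToroidalLie.Toroidal.tKi B m i, v⁆ = 0 := by
    intro m i v
    have h := ToroidalLie.centreOp_tK_eq_zero_of_irreducible H hirr hint hfin hK m (Pi.single i 1)
    rw [show ToroidalLie.toC (Pi.single i 1) = Pi.single i 1 by
      ext j; by_cases hj : j = i <;> simp [ToroidalLie.toC, hj]] at h
    exact LinearMap.congr_fun h v
  have hz : ∀ (z : ToroidalLie.Centre n) (v : V), ⁅ToroidalLie.Toroidal.ofCentre B z, v⁆ = 0 := by
    intro z v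
    rw [← ToroidalLie.centreOp_apply]
    induction z using ToroidalLie.centre_induction with
    | h0 => rw [map_zero, LinearMap.zero_apply]
    | ha x y hx hy => rw [map_add, LinearMap.add_apply, hx, hy, add_zero]
    | hm m u => rw [ToroidalLie.centreOp_tK_eq_zero (hm m), LinearMap.zero_apply]
  refine ⟨fun h1 => ?_, hz⟩
  have hempty : ToroidalLie.centralDegrees B n V = ∅ := by
    refine Set.eq_empty_of_forall_notMem ?_
    rintro u ⟨r, ⟨i, v, hv⟩, -⟩
    exact hv (hm r i v)
  rw [ToroidalLie.centralRank, hempty, Submodule.span_empty, finrank_bot] at h1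
  omega
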